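/- Let $\mathcal X\subset\mathbb R^d$ be closed, let $\mathcal X$ and $\mathcal X^N$ carry their Borel $\sigma$-algebras, and let $\mathbb H$ be a real reproducing kernel Hilbert space (RKHS) of functions on $\mathcal X$ with kernel $k$ and feature map $\phi(x)=k(\cdot,x)\in\mathbb H$. For $N\in\mathbb N$ let $\mathbb H^{\otimes N}$ be the $N$-fold Hilbert space tensor product of $\mathbb H$ (with $\mathbb H^{\otimes 0}=\mathbb R$), regarded as an RKHS on $\mathcal X^N$ whose feature map is $x^{1:N}=(x^1,\dots,x^N)\mapsto\phi(x^1)\otimes\cdots\otimes\phi(x^N)$. Suppose that - ($C_0$-kernel) $\mathbb H\subset C_0(\mathcal X)$, that is, every $f\in\mathbb H$ is a continuous function on $\mathcal X$ vanishing at infinity; - ($L^2$-universality) $\mathbb H$ is dense in $L^2(\pi)$ for every Borel probability measure $\pi$ on $\mathcal X$. Then $\mathbb H^{\otimes N}$ is characteristic: for every Borel probability measure $\rho$ on $\mathcal X^N$ the mean embedding $$\mu_\rho=\int_{\mathcal X^N}\phi(x^1)\otimes\cdots\otimes\phi(x^N)\,d\rho(x^{1:N})\in\mathbb H^{\otimes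 N}$$ exists as a Bochner integral, and the map $\rho\mapsto\mu_\rho$ is injective on the Borel probability measures on $\mathcal X^N$. In other words, the sequence mean embedding determines the sequence distribution. -/

import Mathlib

open MeasureTheory
open scoped TensorProduct ZeroAtInfty InnerProductSpace

/-! ### The Hilbert space tensor power -/

section TensorPower

variable (E : Type*) [NormedAddCommGroup E] [InnerProductSpace ℝ E] (N : ℕ)

/-- The algebraic `N`-fold tensor power of a real inner product space, as a type of its own so that
it carries the inner product below (and not the projective tensor norm). -/
def AlgTensorPower : Type _ := ⨂[ℝ] (_ : Fin N), E

namespace AlgTensorPower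

noncomputable instance : AddCommGroup (AlgTensorPower E N) :=
  inferInstanceAs (AddCommGroup (⨂[ℝ] (_ : Fin N), E))

noncomputable instance : Module ℝ (AlgTensorPower E N) :=
  inferInstanceAs (Module ℝ (⨂[ℝ] (_ : Fin N), E))

variable {E N}

/-- The elementary tensor `f₁ ⊗ ⋯ ⊗ f_N`, as a multilinear map of `(f₁, …, f_N)`. -/
noncomputable def tprod : MultilinearMap ℝ (fun _ : Fin N => E) (AlgTensorPower E N) :=
  PiTensorProduct.tprod ℝ

theorem span_range_tprod :
    Submodule.span ℝ (Set.range (tprod : (Fin N → E) → AlgTensorPower E N)) = ⊤ :=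
  PiTensorProduct.span_tprod_eq_top

/-- The bilinear form on the algebraic tensor power with
`⟨f₁ ⊗ ⋯ ⊗ f_N, g₁ ⊗ ⋯ ⊗ g_N⟩ = ∏ i, ⟨f_i, g_i⟩`. -/
noncomputable def form : AlgTensorPower E N →ₗ[ℝ] AlgTensorPower E N →ₗ[ℝ] ℝ :=
  (PiTensorProduct.map₂ (fun _ : Fin N => innerₗ E)).compr₂
    (PiTensorProduct.lift (MultilinearMap.mkPiAlgebra ℝ (Fin N) ℝ))

theorem form_tprod (f g : Fin N → E) : form (tprod f) (tprod g) = ∏ i, ⟪f i, g i⟫_ℝ := by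
  change PiTensorProduct.lift (MultilinearMap.mkPiAlgebra ℝ (Fin N) ℝ)
    (PiTensorProduct.map₂ (fun _ : Fin N => innerₗ E)
      (PiTensorProduct.tprod ℝ f) (PiTensorProduct.tprod ℝ g)) = _
  rw [PiTensorProduct.map₂_tprod_tprod, PiTensorProduct.lift.tprod]
  simp

theorem form_comm (s t : AlgTensorPower E N) : form s t = form t s := by
  have h : form (E := E) (N := N) = form.flip := by
    refine LinearMap.ext_on_range span_range_tprod fun f => ?_
    refine LinearMap.ext_on_range span_range_tprod fun g => ?_
    simp [form_tprod, real_inner_comm]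
  exact congrArg (fun B => B s t) h

theorem posSemidef_prod_gram {n : ℕ} (f : Fin n → Fin N → E) (S : Finset (Fin N)) :
    (Matrix.of fun a b => ∏ i ∈ S, ⟪f a i, f b i⟫_ℝ).PosSemidef := by
  induction S using Finset.induction_on with
  | empty =>
    have h := Matrix.posSemidef_gram ℝ (fun _ : Fin n => (1 : ℝ))
    have e : (Matrix.of fun a b => ∏ i ∈ (∅ : Finset (Fin N)), ⟪f a i, f b i⟫_ℝ) =
        Matrix.gram ℝ (fun _ : Fin n => (1 : ℝ)) := by
      ext a b
      simp [Matrix.gram]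
    rw [e]
    exact h
  | insert i S hi ih =>
    have h := Matrix.posSemidef_gram ℝ (fun a : Fin n => f a i)
    have e : (Matrix.of fun a b => ∏ j ∈ insert i S, ⟪f a j, f b j⟫_ℝ) =
        (Matrix.gram ℝ (fun a : Fin n => f a i)).hadamard
          (Matrix.of fun a b => ∏ j ∈ S, ⟪f a j, f b j⟫_ℝ) := by
      ext a b
      simp [Matrix.gram, Finset.prod_insert hi]
    rw [e]
    exact h.hadamard ih

theorem form_self_nonneg (t : AlgTensorPower E N) : 0 ≤ form t t := by
  have ht : t ∈ Submodule.span ℝ (Set.range (tprod : (Fin N → E) → AlgTensorPower E N)) := by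
    rw [span_range_tprod]; trivial
  obtain ⟨n, c, g, rfl⟩ := Submodule.mem_span_set'.1 ht
  choose f hf using fun a => (g a).2
  have h := (posSemidef_prod_gram f Finset.univ).dotProduct_mulVec_nonneg c
  refine h.trans_eq ?_
  simp only [← hf, map_sum, map_smul, LinearMap.sum_apply, LinearMap.smul_apply, form_tprod,
    dotProduct, Matrix.mulVec, Matrix.of_apply, smul_eq_mul, star_trivial]
  refine Finset.sum_congr rfl fun a _ => congrArg _ (Finset.sum_congr rfl fun b _ => ?_)
  rw [mul_comm]
  exact congrArg _ (Finset.prod_congr rfl fun i _ => real_inner_comm _ _)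

noncomputable instance : PreInnerProductSpace.Core ℝ (AlgTensorPower E N) where
  inner s t := form s t
  conj_inner_symm s t := form_comm t s
  re_inner_nonneg t := form_self_nonneg t
  add_left r s t := by simp
  smul_left s t c := by simp

noncomputable instance : SeminormedAddCommGroup (AlgTensorPower E N) :=
  InnerProductSpace.Core.toSeminormedAddCommGroup (𝕜 := ℝ)

noncomputable instance : InnerProductSpace ℝ (AlgTensorPower E N) := .ofCore _

theorem inner_tprod (f g : Fin N → E) : ⟪tprod f, tprod g⟫_ℝ = ∏ i, ⟪f i, g i⟫_ℝ :=
  form_tprod f g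

theorem norm_tprod (f : Fin N → E) : ‖tprod f‖ = ∏ i, ‖f i‖ := by
  rw [norm_eq_sqrt_real_inner, inner_tprod]
  simp only [real_inner_self_eq_norm_sq]
  rw [Finset.prod_pow, Real.sqrt_sq (Finset.prod_nonneg fun i _ => norm_nonneg _)]

end AlgTensorPower

/-- The Hilbert space tensor power `E ⊗ ⋯ ⊗ E` (`N` factors): the completion of the algebraic
tensor power for the inner product `⟨f₁ ⊗ ⋯ ⊗ f_N, g₁ ⊗ ⋯ ⊗ g_N⟩ = ∏ i, ⟨f_i, g_i⟩`. -/
def HilbertTensorPower : Type _ := UniformSpace.Completion (AlgTensorPower E N)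

namespace HilbertTensorPower

noncomputable instance : NormedAddCommGroup (HilbertTensorPower E N) :=
  inferInstanceAs (NormedAddCommGroup (UniformSpace.Completion (AlgTensorPower E N)))

noncomputable instance : InnerProductSpace ℝ (HilbertTensorPower E N) :=
  inferInstanceAs (InnerProductSpace ℝ (UniformSpace.Completion (AlgTensorPower E N)))

instance : CompleteSpace (HilbertTensorPower E N) :=
  inferInstanceAs (CompleteSpace (UniformSpace.Completion (AlgTensorPower E N)))

/-- The isometric embedding of the algebraic tensor power with dense range. -/
noncomputable def ofAlg : AlgTensorPower E N →ₗᵢ[ℝ] HilbertTensorPower E N :=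
  UniformSpace.Completion.toComplₗᵢ

theorem denseRange_ofAlg : DenseRange (ofAlg E N) :=
  UniformSpace.Completion.denseRange_coe

variable {E N}

/-- The elementary tensor `f₁ ⊗ ⋯ ⊗ f_N` in the Hilbert space tensor power. -/
noncomputable def tprod :
    ContinuousMultilinearMap ℝ (fun _ : Fin N => E) (HilbertTensorPower E N) :=
  ((ofAlg E N).toLinearMap.compMultilinearMap AlgTensorPower.tprod).mkContinuous 1 fun f => by
    simp [AlgTensorPower.norm_tprod]

theorem tprod_apply (f : Fin N → E) : tprod f = ofAlg E N (AlgTensorPower.tprod f) := rfl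

theorem inner_tprod (f g : Fin N → E) : ⟪tprod f, tprod g⟫_ℝ = ∏ i, ⟪f i, g i⟫_ℝ := by
  rw [tprod_apply, tprod_apply, LinearIsometry.inner_map_map, AlgTensorPower.inner_tprod]

theorem eq_zero_of_inner_tprod {T : HilbertTensorPower E N}
    (h : ∀ f : Fin N → E, ⟪tprod f, T⟫_ℝ = 0) : T = 0 := by
  refine (denseRange_ofAlg E N).eq_zero_of_inner_right ℝ fun t => ?_
  have ht : t ∈ Submodule.span ℝ
      (Set.range (AlgTensorPower.tprod : (Fin N → E) → AlgTensorPower E N)) := by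
    rw [AlgTensorPower.span_range_tprod]; trivial
  induction ht using Submodule.span_induction with
  | mem t ht => obtain ⟨f, rfl⟩ := ht; exact h f
  | zero => simp
  | add s t _ _ hs ht => rw [map_add, inner_add_left, hs, ht, add_zero]
  | smul c t _ ht => rw [map_smul, inner_smul_left, ht, mul_zero]

end HilbertTensorPower

end TensorPower

/-! ### Reproducing kernel Hilbert spaces of real functions -/

namespace RKHS

section Basic

variable {X : Type*} (H : Type*) [NormedAddCommGroup H] [InnerProductSpace ℝ H] [RKHS ℝ H X ℝ]

/-- The canonical feature map `φ x = k (·, x)` of a real reproducing kernel Hilbert space. -/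
noncomputable def featureMap [CompleteSpace H] (x : X) : H := kerFun H x 1

theorem inner_featureMap [CompleteSpace H] (x : X) (f : H) : ⟪featureMap H x, f⟫_ℝ = f x := by
  simp [featureMap]

theorem topologicalClosure_span_featureMap [CompleteSpace H] :
    (Submodule.span ℝ (Set.range (featureMap H : X → H))).topologicalClosure = ⊤ := by
  rw [Submodule.topologicalClosure_eq_top_iff, Submodule.eq_bot_iff]
  intro f hf
  refine RKHS.ext fun x => ?_
  rw [← inner_featureMap H x f, coe_zero]
  exact (Submodule.mem_orthogonal _ f).1 hf _ (Submodule.subset_span ⟨x, rfl⟩)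

/-- All functions in `H` are continuous and vanish at infinity. -/
def HasC0Kernel [TopologicalSpace X] : Prop :=
  ∀ f : H, ∃ g : C₀(X, ℝ), ⇑g = ⇑f

/-- For every probability measure `π`, the space `H` is (after passing to classes modulo `π`-almost
everywhere equality) a dense subset of `L²(π)`. -/
def IsL2Universal [MeasurableSpace X] : Prop :=
  ∀ (π : Measure X) [IsProbabilityMeasure π],
    (∀ f : H, MemLp f 2 π) ∧ Dense {u : Lp ℝ 2 π | ∃ f : H, u =ᵐ[π] f}

/-- The mean embedding `μ_π = ∫ φ(x) dπ(x)`, a Bochner integral in `H`. -/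
noncomputable def meanEmbedding [CompleteSpace H] [MeasurableSpace X] (π : Measure X) : H :=
  ∫ x, featureMap H x ∂π

/-- `H` is characteristic: every probability measure has a mean embedding (the feature map is
Bochner integrable), and the mean embedding determines the probability measure. -/
def IsCharacteristic [CompleteSpace H] [MeasurableSpace X] : Prop :=
  (∀ (π : Measure X) [IsProbabilityMeasure π], Integrable (featureMap H : X → H) π) ∧
    Function.Injective fun π : ProbabilityMeasure X => meanEmbedding H (π : Measure X)

end Basic

section TensorPower

variable {X : Type*} (H : Type*) [NormedAddCommGroup H] [InnerProductSpace ℝ H] [CompleteSpace H]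
  [RKHS ℝ H X ℝ] (N : ℕ)

variable {H N} in
theorem eq_zero_of_inner_tprod_featureMap {T : HilbertTensorPower H N}
    (h : ∀ x : Fin N → X, ⟪HilbertTensorPower.tprod fun i => featureMap H (x i), T⟫_ℝ = 0) :
    T = 0 := by
  refine HilbertTensorPower.eq_zero_of_inner_tprod ?_
  suffices key : ∀ (S : Finset (Fin N)) (f : Fin N → H),
      (∀ i, i ∉ S → ∃ x : X, f i = featureMap H x) →
        ⟪HilbertTensorPower.tprod f, T⟫_ℝ = 0 from
    fun f => key Finset.univ f fun i hi => absurd (Finset.mem_univ i) hi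
  intro S
  induction S using Finset.induction_on with
  | empty =>
    intro f hf
    choose x hx using fun i => hf i (Finset.notMem_empty i)
    rw [show f = fun i => featureMap H (x i) from funext hx]
    exact h x
  | insert i S hi ih =>
    intro f hf
    let L : H →L[ℝ] ℝ :=
      (innerSL ℝ T).comp (HilbertTensorPower.tprod.toContinuousLinearMap f i)
    have hL : ∀ v, L v = ⟪HilbertTensorPower.tprod (Function.update f i v), T⟫_ℝ := fun v => by
      rw [real_inner_comm]; rfl
    have hker : Set.EqOn L (0 : H →L[ℝ] ℝ) (Set.range (featureMap H : X → H)) := by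
      rintro _ ⟨x, rfl⟩
      rw [hL]
      refine ih _ fun j hj => ?_
      by_cases hji : j = i
      · subst hji
        exact ⟨x, by simp⟩
      · obtain ⟨y, hy⟩ := hf j (by simp [hji, hj])
        exact ⟨y, by simp [hji, hy]⟩
    have hdense : Dense (Submodule.span ℝ (Set.range (featureMap H : X → H)) : Set H) :=
      Submodule.dense_iff_topologicalClosure_eq_top.2 (topologicalClosure_span_featureMap H)
    have h0 : L = 0 := ContinuousLinearMap.ext_on hdense hker
    have := hL (f i)
    rw [Function.update_eq_self, h0] at this
    exact this.symm

/-- The tensor power of a reproducing kernel Hilbert space on `X` is a reproducing kernel Hilbert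
space on `X ^ N`: the tensor `T` is the function `x ↦ ⟨φ(x₁) ⊗ ⋯ ⊗ φ(x_N), T⟩`, so that
`f₁ ⊗ ⋯ ⊗ f_N` is the function `x ↦ ∏ i, f_i (x_i)`. -/
noncomputable instance instTensorPower : RKHS ℝ (HilbertTensorPower H N) (Fin N → X) ℝ where
  coeCLM := .pi fun x => innerSL ℝ (HilbertTensorPower.tprod fun i => featureMap H (x i))
  coeCLM_injective := by
    refine (injective_iff_map_eq_zero _).2 fun T hT => ?_
    exact eq_zero_of_inner_tprod_featureMap fun x => congrFun hT x

theorem tensorPower_apply (T : HilbertTensorPower H N) (x : Fin N → X) :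
    T x = ⟪HilbertTensorPower.tprod fun i => featureMap H (x i), T⟫_ℝ := rfl

theorem tprod_apply (f : Fin N → H) (x : Fin N → X) :
    (HilbertTensorPower.tprod f) x = ∏ i, f i (x i) := by
  simp [tensorPower_apply, HilbertTensorPower.inner_tprod, inner_featureMap]

/-- The canonical feature map of the tensor power is `x ↦ φ(x₁) ⊗ ⋯ ⊗ φ(x_N)`. -/
theorem featureMap_tensorPower (x : Fin N → X) :
    featureMap (HilbertTensorPower H N) x =
      HilbertTensorPower.tprod fun i => featureMap H (x i) := by
  refine ext_inner_right ℝ fun T => ?_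
  rw [inner_featureMap, tensorPower_apply]

end TensorPower

end RKHS

/-! Pairing `μ_ρ` with `f₁ ⊗ ⋯ ⊗ f_N` gives `∫ ∏ f_i(x_i) dρ`, so equal embeddings give equal
integrals of all products of functions in `H`. The factors are then replaced one at a time by
bounded measurable functions: while the other factors stay bounded, changing the `i`-th one costs at
most a constant times an `L¹` distance under the `i`-th marginal, and `L²`-universality for the
average of the marginals of `ρ` and `σ` makes this small for both measures
(`IsL2Universal.integral_comp_mul_eq`). Only density on `X` is used, never on `X ^ N`. Indicators
then show that `ρ` and `σ` agree on boxes, a generating π-system. Integrability holds because the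
`C₀` condition makes `H` separable and the feature map bounded and measurable. -/

theorem measurable_of_forall_measurable_inner {Ω E : Type*} [MeasurableSpace Ω]
    [NormedAddCommGroup E] [InnerProductSpace ℝ E] [SecondCountableTopology E]
    [MeasurableSpace E] [BorelSpace E] {F : Ω → E} (h : ∀ v, Measurable fun x => ⟪F x, v⟫_ℝ) :
    Measurable F := by
  have hnorm : ∀ v, Measurable fun x => ‖F x - v‖ := by
    intro v
    refine measurable_of_Iic fun r => ?_
    rcases lt_or_ge r 0 with hr | hr
    · convert MeasurableSet.empty
      ext x
      simpa using hr.trans_le (norm_nonneg _)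
    -- A norm bound is equivalent to countably many scalar ones: by density they hold for all `w`,
    -- and `w = F x - v` recovers the norm.
    have key : (fun x => ‖F x - v‖) ⁻¹' Set.Iic r =
        ⋂ n : ℕ, {x | ⟪F x - v, TopologicalSpace.denseSeq E n⟫_ℝ ≤
          r * ‖TopologicalSpace.denseSeq E n‖} := by
      ext x
      simp only [Set.mem_preimage, Set.mem_Iic, Set.mem_iInter, Set.mem_ofPred_eq]
      refine ⟨fun hx n => (real_inner_le_norm _ _).trans (by gcongr), fun hx => ?_⟩
      have hall : ∀ w, ⟪F x - v, w⟫_ℝ ≤ r * ‖w‖ := fun w =>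
        (TopologicalSpace.denseRange_denseSeq E).induction_on w
          (isClosed_le (by fun_prop) (by fun_prop)) hx
      have hself := hall (F x - v)
      rw [real_inner_self_eq_norm_mul_norm] at hself
      rcases (norm_nonneg (F x - v)).eq_or_lt with h0 | h0
      · rwa [← h0]
      · exact le_of_mul_le_mul_right hself h0
    rw [key]
    refine MeasurableSet.iInter fun n => measurableSet_le ?_ measurable_const
    simp only [inner_sub_left]
    exact (h _).sub_const _
  refine measurable_of_isOpen fun U hU => ?_
  choose! r hr using Metric.isOpen_iff.1 hU
  obtain ⟨T, hTU, hTc, hT⟩ := TopologicalSpace.isOpen_biUnion_countable U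
    (fun y => Metric.ball y (r y)) fun _ _ => Metric.isOpen_ball
  have hUeq : U = ⋃ y ∈ T, Metric.ball y (r y) := by
    rw [hT]
    refine Set.Subset.antisymm (fun y hy => Set.mem_biUnion hy (Metric.mem_ball_self (hr y hy).1))
      (Set.iUnion₂_subset fun y hy => (hr y hy).2)
  rw [hUeq, Set.preimage_iUnion₂]
  refine MeasurableSet.biUnion hTc fun y _ => ?_
  have : F ⁻¹' Metric.ball y (r y) = {x | ‖F x - y‖ < r y} := by
    ext x; simp [dist_eq_norm]
  rw [this]
  exact measurableSet_lt (hnorm y) measurable_const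

namespace RKHS

/-! ### Boundedness, measurability and integrability of the feature map -/

section FeatureMap

variable {X : Type*} [TopologicalSpace X] {H : Type*} [NormedAddCommGroup H]
  [InnerProductSpace ℝ H] [RKHS ℝ H X ℝ]

theorem HasC0Kernel.continuous (hC0 : HasC0Kernel (X := X) H) (f : H) : Continuous (f : X → ℝ) := by
  obtain ⟨g, hg⟩ := hC0 f
  exact hg ▸ g.continuous

theorem HasC0Kernel.exists_abs_apply_le (hC0 : HasC0Kernel (X := X) H) (f : H) :
    ∃ C, ∀ x : X, |f x| ≤ C := by
  obtain ⟨g, hg⟩ := hC0 f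
  refine ⟨‖g.toBCF‖, fun x => ?_⟩
  rw [← hg]
  exact g.toBCF.norm_coe_le_norm x

variable [CompleteSpace H]

/-- Uniform boundedness principle: the evaluations `f ↦ f x` are pointwise bounded, since each `f`
is a bounded function. -/
theorem HasC0Kernel.exists_norm_featureMap_le (hC0 : HasC0Kernel (X := X) H) :
    ∃ C, ∀ x : X, ‖featureMap H x‖ ≤ C := by
  obtain ⟨C, hC⟩ := banach_steinhaus (g := fun x : X => innerSL ℝ (featureMap H x)) fun f => by
    obtain ⟨C, hC⟩ := hC0.exists_abs_apply_le f
    exact ⟨C, fun x => by simpa [inner_featureMap] using hC x⟩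
  exact ⟨C, fun x => by simpa using hC x⟩

/-- A function orthogonal to the features of a dense set of points vanishes on that set, hence
everywhere by continuity; countably many features therefore span a dense subspace. -/
theorem HasC0Kernel.separableSpace [TopologicalSpace.SeparableSpace X]
    (hC0 : HasC0Kernel (X := X) H) : TopologicalSpace.SeparableSpace H := by
  obtain ⟨S, hSc, hSd⟩ := TopologicalSpace.exists_countable_dense X
  have htop : (Submodule.span ℝ (featureMap H '' S)).topologicalClosure = ⊤ := by
    rw [Submodule.topologicalClosure_eq_top_iff, Submodule.eq_bot_iff]
    intro f hf
    have hS : Set.EqOn (f : X → ℝ) 0 S := fun x hx => by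
      rw [← inner_featureMap H x f]
      exact (Submodule.mem_orthogonal _ f).1 hf _ (Submodule.subset_span ⟨x, hx, rfl⟩)
    have := Continuous.ext_on hSd (hC0.continuous f) continuous_zero hS
    exact RKHS.ext fun x => by rw [this, coe_zero]
  rw [← TopologicalSpace.isSeparable_univ_iff]
  have := ((hSc.image (featureMap H)).isSeparable.span (R := ℝ)).closure
  rwa [← Submodule.topologicalClosure_coe, htop, Submodule.top_coe] at this

theorem HasC0Kernel.stronglyMeasurable_featureMap [TopologicalSpace.SeparableSpace X]
    [MeasurableSpace X] [OpensMeasurableSpace X] (hC0 : HasC0Kernel (X := X) H) :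
    StronglyMeasurable (featureMap H : X → H) := by
  have := hC0.separableSpace
  have : SecondCountableTopology H := UniformSpace.secondCountable_of_separable H
  borelize H
  refine (measurable_of_forall_measurable_inner fun f => ?_).stronglyMeasurable
  simpa only [inner_featureMap] using (hC0.continuous f).measurable

theorem HasC0Kernel.integrable_featureMap_tensorPower [TopologicalSpace.SeparableSpace X]
    [MeasurableSpace X] [OpensMeasurableSpace X] (hC0 : HasC0Kernel (X := X) H) (N : ℕ)
    (ρ : Measure (Fin N → X)) [IsFiniteMeasure ρ] :
    Integrable (featureMap (HilbertTensorPower H N) : (Fin N → X) → HilbertTensorPower H N) ρ := by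
  obtain ⟨C, hC⟩ := hC0.exists_norm_featureMap_le
  have hmeas : StronglyMeasurable
      (featureMap (HilbertTensorPower H N) : (Fin N → X) → HilbertTensorPower H N) := by
    simp only [funext (featureMap_tensorPower H N)]
    have := hC0.separableSpace
    have : SecondCountableTopology H := UniformSpace.secondCountable_of_separable H
    borelize H
    -- Measurability is obtained in `H ^ N`, where second countability identifies the product and
    -- Borel σ-algebras, and passes through the continuous map `tprod`.
    exact HilbertTensorPower.tprod.cont.comp_stronglyMeasurable
      (measurable_pi_lambda _ fun i => hC0.stronglyMeasurable_featureMap.measurable.comp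
        (measurable_pi_apply i)).stronglyMeasurable
  refine Integrable.of_bound hmeas.aestronglyMeasurable (C ^ N) (.of_forall fun x => ?_)
  rw [featureMap_tensorPower, HilbertTensorPower.tprod_apply, LinearIsometry.norm_map,
    AlgTensorPower.norm_tprod]
  simpa using Finset.prod_le_prod (s := Finset.univ) (fun i _ => norm_nonneg _)
    fun i _ => hC (x i)

end FeatureMap

/-! ### From `L²`-universality to equality of measures on the product -/

section L2

variable {X : Type*} [MeasurableSpace X] {H : Type*} [NormedAddCommGroup H]
  [InnerProductSpace ℝ H] [RKHS ℝ H X ℝ]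

theorem IsL2Universal.exists_integral_abs_sub_lt (hL2 : IsL2Universal (X := X) H)
    (π : Measure X) [IsProbabilityMeasure π] {g : X → ℝ} (hg : MemLp g 2 π) {ε : ℝ} (hε : 0 < ε) :
    ∃ f : H, ∫ x, |f x - g x| ∂π < ε := by
  obtain ⟨u, hu, f, hf⟩ := Metric.dense_iff.1 (hL2 π).2 (hg.toLp g) ε hε
  have hfm : MemLp f 2 π := (hL2 π).1 f
  refine ⟨f, ?_⟩
  have hfu : u = hfm.toLp f := Lp.ext (hf.trans hfm.coeFn_toLp.symm)
  rw [Metric.mem_ball, ← edist_lt_ofReal, hfu, Lp.edist_toLp_toLp] at hu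
  have hsub : MemLp (fun x => f x - g x) 2 π := hfm.sub hg
  have hle := (eLpNorm_le_eLpNorm_of_exponent_le one_le_two hsub.1).trans_lt hu
  rw [eLpNorm_one_eq_lintegral_enorm,
    ← ofReal_integral_norm_eq_lintegral_enorm (hsub.integrable one_le_two)] at hle
  exact (ENNReal.ofReal_lt_ofReal_iff hε).1 hle

/-- The single replacement step: `p` is a coordinate and `G` the product of the remaining factors.
-/
theorem IsL2Universal.integral_comp_mul_eq (hL2 : IsL2Universal (X := X) H)
    {Ω : Type*} [MeasurableSpace Ω] {ρ σ : Measure Ω} [IsProbabilityMeasure ρ]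
    [IsProbabilityMeasure σ] {p : Ω → X} (hp : Measurable p) {G : Ω → ℝ} (hG : Measurable G)
    {C : ℝ} (hC : ∀ x, |G x| ≤ C)
    (h : ∀ f : H, ∫ x, f (p x) * G x ∂ρ = ∫ x, f (p x) * G x ∂σ)
    {g : X → ℝ} (hg : Measurable g) {B : ℝ} (hB : ∀ x, |g x| ≤ B) :
    ∫ x, g (p x) * G x ∂ρ = ∫ x, g (p x) * G x ∂σ := by
  have hC0 : 0 ≤ C := by
    obtain ⟨x⟩ := nonempty_of_isProbabilityMeasure ρ
    exact (abs_nonneg _).trans (hC x)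
  have hgL : ∀ (π : Measure X) [IsProbabilityMeasure π], MemLp g 2 π := fun π _ =>
    MemLp.of_bound hg.aestronglyMeasurable B (.of_forall hB)
  have hint : ∀ (τ : Measure Ω) [IsProbabilityMeasure τ] (f : H),
      Integrable (fun x => f (p x)) τ ∧ Integrable (fun x => g (p x)) τ := fun τ _ f => by
    have := Measure.isProbabilityMeasure_map (μ := τ) hp.aemeasurable
    exact ⟨(((hL2 (τ.map p)).1 f).integrable one_le_two).comp_measurable hp,
      ((hgL (τ.map p)).integrable one_le_two).comp_measurable hp⟩
  have hGb : ∀ (τ : Measure Ω), ∀ᵐ x ∂τ, ‖G x‖ ≤ C := fun τ => .of_forall hC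
  have hdiff : ∀ (τ : Measure Ω) [IsProbabilityMeasure τ] (f : H),
      |∫ x, f (p x) * G x ∂τ - ∫ x, g (p x) * G x ∂τ| ≤ C * ∫ x, |f x - g x| ∂(τ.map p) := by
    intro τ _ f
    obtain ⟨hf', hg'⟩ := hint τ f
    have := Measure.isProbabilityMeasure_map (μ := τ) hp.aemeasurable
    rw [← integral_sub (hf'.mul_bdd hG.aestronglyMeasurable (hGb τ))
      (hg'.mul_bdd hG.aestronglyMeasurable (hGb τ)),
      integral_map hp.aemeasurable (f := fun x => |f x - g x|)
        (((hL2 (τ.map p)).1 f).1.sub hg.aestronglyMeasurable).norm,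
      ← integral_const_mul]
    refine (abs_integral_le_integral_abs).trans (integral_mono_of_nonneg
      (.of_forall fun x => abs_nonneg _) ((hf'.sub hg').abs.const_mul C) (.of_forall fun x => ?_))
    simp only [← sub_mul, abs_mul]
    rw [mul_comm]
    exact mul_le_mul_of_nonneg_right (hC x) (abs_nonneg _)
  have hρ := Measure.isProbabilityMeasure_map (μ := ρ) hp.aemeasurable
  have hσ := Measure.isProbabilityMeasure_map (μ := σ) hp.aemeasurable
  -- One `f` must approximate `g` under both marginals, so universality is applied to their average.
  let π : Measure X := (2⁻¹ : ENNReal) • (ρ.map p + σ.map p)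
  have hπ : IsProbabilityMeasure π := ⟨by
    simp [π, ENNReal.inv_two_add_inv_two]⟩
  have hπint : ∀ f : H, ∫ x, |f x - g x| ∂(ρ.map p) + ∫ x, |f x - g x| ∂(σ.map p) =
      2 * ∫ x, |f x - g x| ∂π := by
    intro f
    have hi : ∀ (τ : Measure X) [IsProbabilityMeasure τ],
        Integrable (fun x => |f x - g x|) τ := fun τ _ =>
      ((((hL2 τ).1 f).sub (hgL τ)).integrable one_le_two).abs
    rw [integral_smul_measure, integral_add_measure (hi _) (hi _)]
    simp
  refine eq_of_forall_dist_le fun ε hε => ?_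
  -- The two errors add up to `2 * C` times the integral; `C + 1` avoids dividing by zero when `C =
  -- 0`.
  obtain ⟨f, hf⟩ := hL2.exists_integral_abs_sub_lt π (hgL π)
    (show 0 < ε / (2 * (C + 1)) by positivity)
  rw [lt_div_iff₀ (by positivity)] at hf
  have h1 := hdiff ρ f
  have h2 := hdiff σ f
  have h3 := hπint f
  have h4 : 0 ≤ ∫ x, |f x - g x| ∂π := integral_nonneg fun x => abs_nonneg _
  rw [h f] at h1
  rw [Real.dist_eq]
  calc |∫ x, g (p x) * G x ∂ρ - ∫ x, g (p x) * G x ∂σ|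
      ≤ |∫ x, f (p x) * G x ∂σ - ∫ x, g (p x) * G x ∂ρ|
        + |∫ x, f (p x) * G x ∂σ - ∫ x, g (p x) * G x ∂σ| := by
        rw [abs_sub_comm (∫ x, f (p x) * G x ∂σ) (∫ x, g (p x) * G x ∂ρ)]
        exact abs_sub_le _ _ _
    _ ≤ C * (2 * ∫ x, |f x - g x| ∂π) := by rw [← h3, mul_add]; exact add_le_add h1 h2
    _ ≤ ε := by linarith

theorem IsL2Universal.ext_of_integral_prod_eq (hL2 : IsL2Universal (X := X) H)
    (hmeas : ∀ f : H, Measurable (f : X → ℝ)) (hbdd : ∀ f : H, ∃ C, ∀ x : X, |f x| ≤ C)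
    {N : ℕ} {ρ σ : Measure (Fin N → X)} [IsProbabilityMeasure ρ] [IsProbabilityMeasure σ]
    (h : ∀ f : Fin N → H, ∫ x, ∏ i, f i (x i) ∂ρ = ∫ x, ∏ i, f i (x i) ∂σ) : ρ = σ := by
  -- `S` collects the coordinates whose factor has been freed from `H`.
  have key : ∀ (S : Finset (Fin N)) (g : Fin N → X → ℝ), (∀ i, Measurable (g i)) →
      (∀ i, ∃ C, ∀ x, |g i x| ≤ C) → (∀ i, i ∉ S → ∃ f : H, g i = f) →
      ∫ x, ∏ i, g i (x i) ∂ρ = ∫ x, ∏ i, g i (x i) ∂σ := by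
    intro S
    induction S using Finset.induction_on with
    | empty =>
      intro g _ _ hg
      choose f hf using fun i => hg i (Finset.notMem_empty i)
      simpa only [hf] using h f
    | insert i S hi ih =>
      intro g hgm hgb hg
      have hsplit : ∀ (u : X → ℝ) (x : Fin N → X),
          ∏ j, Function.update g i u j (x j) =
            u (x i) * ∏ j ∈ Finset.univ.erase i, g j (x j) := by
        intro u x
        rw [← Finset.mul_prod_erase _ _ (Finset.mem_univ i), Function.update_self]
        congr 1
        refine Finset.prod_congr rfl fun j hj => ?_
        rw [Function.update_of_ne (Finset.ne_of_mem_erase hj)]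
      choose C hC using hgb
      obtain ⟨B, hB⟩ : ∃ B, ∀ x : Fin N → X, |∏ j ∈ Finset.univ.erase i, g j (x j)| ≤ B :=
        ⟨∏ j ∈ Finset.univ.erase i, C j, fun x => by
          rw [Finset.abs_prod]
          exact Finset.prod_le_prod (fun _ _ => abs_nonneg _) fun j _ => hC j (x j)⟩
      have := hL2.integral_comp_mul_eq
        (G := fun x : Fin N → X => ∏ j ∈ Finset.univ.erase i, g j (x j)) (ρ := ρ) (σ := σ) (measurable_pi_apply i)
        (Finset.measurable_fun_prod _ fun j _ => (hgm j).comp (measurable_pi_apply j)) hB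
        (fun f => by
          have := ih (Function.update g i f) (fun j => ?_) (fun j => ?_) fun j hj => ?_
          · simpa only [hsplit] using this
          · rcases eq_or_ne j i with rfl | hji
            · simpa using hmeas f
            · simpa [hji] using hgm j
          · rcases eq_or_ne j i with rfl | hji
            · simpa using hbdd f
            · simpa [hji] using ⟨C j, hC j⟩
          · rcases eq_or_ne j i with rfl | hji
            · exact ⟨f, by simp⟩
            · simpa [hji] using hg j (by simp [hji, hj]))
        (hgm i) (hC i)
      simpa only [← hsplit, Function.update_eq_self] using this
  refine ext_of_generate_finite _ generateFrom_pi.symm isPiSystem_pi ?_ (by simp)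
  rintro _ ⟨A, hA, rfl⟩
  have hA' : ∀ i, MeasurableSet (A i) := fun i => hA i (Set.mem_univ i)
  have hAm : MeasurableSet (Set.univ.pi A) := .univ_pi hA'
  have hprod : ∀ x : Fin N → X, ∏ i, (A i).indicator (fun _ => (1 : ℝ)) (x i) =
      (Set.univ.pi A).indicator (fun _ => 1) x := by
    intro x
    by_cases hx : x ∈ Set.univ.pi A
    · rw [Set.indicator_of_mem hx]
      exact Finset.prod_eq_one fun i _ => Set.indicator_of_mem (hx i (Set.mem_univ i)) _
    · rw [Set.indicator_of_notMem hx]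
      simp only [Set.mem_pi, Set.mem_univ, true_imp_iff, not_forall] at hx
      obtain ⟨i, hi⟩ := hx
      exact Finset.prod_eq_zero (Finset.mem_univ i) (Set.indicator_of_notMem hi _)
  have := key Finset.univ (fun i => (A i).indicator fun _ => 1)
    (fun i => measurable_const.indicator (hA' i))
    (fun i => ⟨1, fun x => by
      by_cases hx : x ∈ A i <;> simp [hx]⟩)
    fun i hi => absurd (Finset.mem_univ i) hi
  simp only [hprod, integral_indicator_const _ hAm, smul_eq_mul, mul_one] at this
  exact (measureReal_eq_measureReal_iff).1 this

end L2

theorem isCharacteristic_tensorPower {X : Type*} [TopologicalSpace X]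
    [TopologicalSpace.SeparableSpace X] [MeasurableSpace X] [OpensMeasurableSpace X]
    (H : Type*) [NormedAddCommGroup H] [InnerProductSpace ℝ H] [CompleteSpace H] [RKHS ℝ H X ℝ]
    (hC0 : HasC0Kernel (X := X) H) (hL2 : IsL2Universal (X := X) H) (N : ℕ) :
    IsCharacteristic (X := Fin N → X) (HilbertTensorPower H N) := by
  refine ⟨fun ρ _ => hC0.integrable_featureMap_tensorPower N ρ, fun ρ σ hρσ => ?_⟩
  have := ρ.2
  have := σ.2
  refine Subtype.ext (hL2.ext_of_integral_prod_eq (fun f => (hC0.continuous f).measurable)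
    hC0.exists_abs_apply_le fun f => ?_)
  -- The Bochner integral commutes with the pairing, and `tprod f` evaluates to the product of the
  -- `f i (x i)`.
  have hmean : ∀ τ : ProbabilityMeasure (Fin N → X),
      ∫ x, ∏ i, f i (x i) ∂(τ : Measure (Fin N → X)) =
        ⟪HilbertTensorPower.tprod f, meanEmbedding (HilbertTensorPower H N)
          (τ : Measure (Fin N → X))⟫_ℝ := by
    intro τ
    rw [meanEmbedding, ← integral_inner (hC0.integrable_featureMap_tensorPower N _)]
    refine integral_congr_ae (.of_forall fun x => ?_)
    simp only
    rw [real_inner_comm, inner_featureMap, tprod_apply]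
  exact (hmean ρ).trans ((congrArg _ hρσ).trans (hmean σ).symm)

end RKHS

theorem mainTheorem6 {d : ℕ} (X : Set (EuclideanSpace ℝ (Fin d))) (hX : IsClosed X)
    (H : Type*) [NormedAddCommGroup H] [InnerProductSpace ℝ H] [CompleteSpace H] [RKHS ℝ H X ℝ]
    (hC0 : RKHS.HasC0Kernel H) (hL2 : RKHS.IsL2Universal H) (N : ℕ) :
    RKHS.IsCharacteristic (HilbertTensorPower H N) :=
  RKHS.isCharacteristic_tensorPower H hC0 hL2 N
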